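/- **Setting.** There are $N\ge 2$ agents, $K\ge 1$ arms and $T\ge 1$ rounds. In round $t\in\{1,\dots,T\}$ a utility matrix $u_t\in[0,1]^{K\times N}$ is drawn i.i.d. from an unknown distribution with mean matrix $u$ (the entries of one matrix may be dependent). The learner picks $p_t$ in the simplex $\Delta_K$, using the past only, samples an arm $i_t\sim p_t$, and observes $u_{t,i_t,n}$ for all agents $n$. Let $\mathrm{NSW}(\mu)=\prod_{n=1}^N\mu_n^{1/N}$ and $$\mathrm{Reg}_{\mathrm{sto}}=T\max_{p\in\Delta_K}\mathrm{NSW}(u^\top p)-\mathbb E\Big[\sum_{t=1}^T\mathrm{NSW}(u^\top p_t)\Big],$$ where the expectation is over all randomness of the learner and of the utilities. **Algorithm.** Let $N_0=1+18\log(KT)$. In rounds $t\le KN_0$ select $i_t=\lceil t/N_0\rceil$ (that is, $p_t$ is the point mass at this arm). In rounds $t>KN_0$ choose any $p_t\in\arg\max_{p\in\Delta_K}\mathrm{NSW}(\widehat u_t^\top p)$ and sample $i_t\sim p_t$. Here, with $N_{t+1,i}=|\{\tau\le t: i_\tau=i\}|$ and $\bar u_{t,i,n}=\frac1{N_{t+1,i}}\sum_{\tau\le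 t}u_{\tau,i,n}\mathbf 1\{i_\tau=i\}$, $$\widehat u_{t+1,i,n}=\bar u_{t,i,n}+4\sqrt{\frac{\bar u_{t,i,n}\log(NKT^2)}{N_{t+1,i}}}+\frac{8\log(NKT^2)}{N_{t+1,i}}$$ (and $\widehat u_{t+1,i,n}=1$ as long as $N_{t+1,i}=0$). **Theorem.** The algorithm achieves $\mathrm{Reg}_{\mathrm{sto}}=\widetilde O\big(K^{2/N}T^{(N-1)/N}+K\big)$, where $\widetilde O$ hides factors polylogarithmic in $N,K,T$. That is, there are universal constants $C$ and $m$ such that for all $N\ge2$, $K\ge1$, $T\ge1$, all utility distributions on $[0,1]^{K\times N}$ and all rules for breaking ties in the $\arg\max$ that use the past only, $$\mathrm{Reg}_{\mathrm{sto}}\le C\,\big(1+\log(NKT)\big)^m\Big(K^{2/N}\,T^{(N-1)/N}+K\Big).$$ -/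

import Mathlib

open MeasureTheory ProbabilityTheory

noncomputable section

namespace NashBandit

/-- Nash social welfare of a vector of `N` utilities: the geometric mean. -/
def NSW {N : ℕ} (x : Fin N → ℝ) : ℝ :=
  ∏ n, x n ^ (1 / (N : ℝ))

/-- The vector `uᵀ p` of the agents' expected utilities when an arm is drawn from `p` and `u i n` is
the utility of agent `n` for arm `i`. -/
def expectedUtility {K N : ℕ} (u : Fin K → Fin N → ℝ) (p : Fin K → ℝ) : Fin N → ℝ :=
  fun n => ∑ i, p i * u i n

/-- The welfare `NSW(uᵀ p)` of the strategy `p` under the utility matrix `u`. -/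
def welfare {K N : ℕ} (u : Fin K → Fin N → ℝ) (p : Fin K → ℝ) : ℝ :=
  NSW (expectedUtility u p)

/-- The mean utility matrix of a distribution `ν` over utility matrices. -/
def meanUtility {K N : ℕ} (ν : Measure (Fin K → Fin N → ℝ)) : Fin K → Fin N → ℝ :=
  fun i n => ∫ v, v i n ∂ν

/-! ### Quantities computed by the algorithm

Below `a t` is the arm selected in round `t` and `v t` the utility matrix of round `t`, where rounds
are numbered from `1`. Of `v t` only the row `a t` is used. -/

/-- Number of times arm `i` is selected in the rounds `1, …, t`. -/
def pullCount {K : ℕ} (a : ℕ → Fin K) (t : ℕ) (i : Fin K) : ℕ :=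
  ((Finset.Icc 1 t).filter fun τ => a τ = i).card

/-- Empirical mean utility of agent `n` for arm `i` over the rounds `1, …, t` in which `i` is
selected. -/
def empiricalMean {K N : ℕ} (a : ℕ → Fin K) (v : ℕ → Fin K → Fin N → ℝ) (t : ℕ)
    (i : Fin K) (n : Fin N) : ℝ :=
  (∑ τ ∈ Finset.Icc 1 t, if a τ = i then v τ i n else 0) / (pullCount a t i : ℝ)

/-- The upper confidence utility matrix with Bernstein-type widths, as it stands after `t` rounds
(so it is used in round `t + 1`), for horizon `T`. Entries of arms which have not been selected yet
keep their initial value `1`. -/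
def upperConfidence {K N : ℕ} (T : ℕ) (a : ℕ → Fin K) (v : ℕ → Fin K → Fin N → ℝ) (t : ℕ) :
    Fin K → Fin N → ℝ :=
  fun i n =>
    if pullCount a t i = 0 then 1
    else
      empiricalMean a v t i n
        + 4 * √(empiricalMean a v t i n * Real.log (N * K * T ^ 2) / pullCount a t i)
        + 8 * Real.log (N * K * T ^ 2) / pullCount a t i

/-! ### The interaction between learner and environment -/

/-- The stochastic bandit protocol over `T` rounds. `U t` is the utility matrix, `p t` the learner's
strategy and `I t` the selected arm in round `t ∈ {1, …, T}`; `ℱ t` is the information available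
at the end of round `t`. The matrix of each round has law `ν` and is independent of the past and of
the arm selected in that round; given the past, the arm is drawn from the learner's strategy. -/
structure IsBanditInteraction {Ω : Type*} {mΩ : MeasurableSpace Ω} {K N : ℕ} (T : ℕ)
    (ν : Measure (Fin K → Fin N → ℝ)) (μ : Measure Ω) (ℱ : Filtration ℕ mΩ)
    (U : ℕ → Ω → Fin K → Fin N → ℝ) (p : ℕ → Ω → Fin K → ℝ) (I : ℕ → Ω → Fin K) : Prop where
  utility_measurable : ∀ t < T, Measurable[ℱ (t + 1)] (U (t + 1))
  arm_measurable : ∀ t < T, Measurable[ℱ (t + 1)] (I (t + 1))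
  utility_law : ∀ t < T, HasLaw (U (t + 1)) ν μ
  utility_indep : ∀ t < T,
    Indep (MeasurableSpace.comap (U (t + 1)) inferInstance)
      (ℱ t ⊔ MeasurableSpace.comap (I (t + 1)) inferInstance) μ
  strategy_measurable : ∀ t < T, Measurable[ℱ t] (p (t + 1))
  strategy_mem : ∀ t < T, ∀ᵐ ω ∂μ, p (t + 1) ω ∈ stdSimplex ℝ (Fin K)
  arm_law : ∀ t < T, ∀ i : Fin K,
    μ[Set.indicator {ω | I (t + 1) ω = i} (fun _ => (1 : ℝ)) | ℱ t] =ᵐ[μ] fun ω => p (t + 1) ω i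

/-- The learner plays UCB with warm-up length `N₀`: in a round `t ≤ K N₀` it selects the arm number
`⌈t / N₀⌉` (arms being numbered `1, …, K`), and in every later round its strategy maximizes the
welfare under the upper confidence utility matrix over the simplex, ties being broken arbitrarily. -/
structure PlaysUCB {Ω : Type*} {mΩ : MeasurableSpace Ω} {K N : ℕ} (T : ℕ) (N₀ : ℝ)
    (μ : Measure Ω) (U : ℕ → Ω → Fin K → Fin N → ℝ) (p : ℕ → Ω → Fin K → ℝ)
    (I : ℕ → Ω → Fin K) : Prop where
  warmup : ∀ t < T, ((t + 1 : ℕ) : ℝ) ≤ K * N₀ → ∀ᵐ ω ∂μ, ∀ i : Fin K,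
    p (t + 1) ω i = if (i : ℕ) + 1 = ⌈((t + 1 : ℕ) : ℝ) / N₀⌉₊ then 1 else 0
  optimistic : ∀ t < T, K * N₀ < ((t + 1 : ℕ) : ℝ) → ∀ᵐ ω ∂μ,
    IsMaxOn (welfare (upperConfidence T (fun τ => I τ ω) (fun τ => U τ ω) t))
      (stdSimplex ℝ (Fin K)) (p (t + 1) ω)

/-- The regret of the strategies `p 1, …, p T` against the best fixed strategy, for the mean utility
matrix `u`. -/
def regret {Ω : Type*} {mΩ : MeasurableSpace Ω} {K N : ℕ} (T : ℕ) (u : Fin K → Fin N → ℝ)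
    (μ : Measure Ω) (p : ℕ → Ω → Fin K → ℝ) : ℝ :=
  T * sSup (welfare u '' stdSimplex ℝ (Fin K))
    - ∫ ω, ∑ t ∈ Finset.Icc 1 T, welfare u (p t ω) ∂μ

end NashBandit

end

namespace NashBandit

/-! ### The Nash social welfare -/

/-! The argument is optimism combined with a Hölder-type stability of the welfare. With `L = log (N
K T ^ 2)`, Bernstein widths say that, off a rare event, `u ≤ û ≤ (√u + √g)²` entrywise, where `g i =
25 L / max (pullCount i) 1`. This form survives averaging over arms: the triangle inequality in
L²(p) (`sum_mul_sqrt_add_sqrt_sq_le`) gives the same bound for the expected utilities, with `w = ∑ p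
i * g i` for all agents. `NSW_perturb` then bounds the welfare gain by `16 (w ^ (1/N) + w)`, with a
constant free of `N`.

The power is linearized at a level `a` (`rpow_le_add_mul`), so only expectations of `w` matter. As
the arm is drawn from `p`, the mean of `w` is that of `g` at the selected arm, and these widths sum
to `O(K L log T)` along every path (`sum_inv_max_pullCount_le`). At `a = K / T` the regret is of
order `K ^ (1/N) T ^ (1 - 1/N) + K` up to logarithms, and `K ^ (1/N) ≤ K ^ (2/N)`.

The rare event is controlled by exponential supermartingales (`lintegral_exp_logWealth_le_one`),
Markov's inequality and a union bound. Warm-up rounds cost at most 1 each. -/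

theorem NSW_mono {N : ℕ} {x y : Fin N → ℝ} (hx : ∀ n, 0 ≤ x n) (hxy : ∀ n, x n ≤ y n) :
    NSW x ≤ NSW y :=
  Finset.prod_le_prod (fun n _ => Real.rpow_nonneg (hx n) _)
    fun n _ => Real.rpow_le_rpow (hx n) (hxy n) (by positivity)

theorem NSW_nonneg {N : ℕ} {x : Fin N → ℝ} (hx : ∀ n, 0 ≤ x n) : 0 ≤ NSW x :=
  Finset.prod_nonneg fun n _ => Real.rpow_nonneg (hx n) _

theorem prod_rpow_one_div {N : ℕ} (hN : N ≠ 0) {c : ℝ} (hc : 0 ≤ c) :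
    ∏ _n : Fin N, c ^ (1 / (N : ℝ)) = c := by
  rw [Finset.prod_const, Finset.card_univ, Fintype.card_fin, ← Real.rpow_natCast,
    ← Real.rpow_mul hc, one_div, inv_mul_cancel₀ (by exact_mod_cast hN), Real.rpow_one]

theorem NSW_le_one {N : ℕ} {x : Fin N → ℝ} (hx : ∀ n, x n ∈ Set.Icc (0 : ℝ) 1) : NSW x ≤ 1 :=
  Finset.prod_le_one (fun n _ => Real.rpow_nonneg (hx n).1 _)
    fun n _ => Real.rpow_le_one (hx n).1 (hx n).2 (by positivity)

/-- A welfare is at most the `N`-th root of each of its factors, if all utilities are at most `1`. -/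
theorem NSW_le_rpow {N : ℕ} {x : Fin N → ℝ} (hx : ∀ n, x n ∈ Set.Icc (0 : ℝ) 1) (n : Fin N) :
    NSW x ≤ x n ^ (1 / (N : ℝ)) := by
  unfold NSW
  rw [← Finset.mul_prod_erase _ _ (Finset.mem_univ n)]
  refine mul_le_of_le_one_right (Real.rpow_nonneg (hx n).1 _) ?_
  exact Finset.prod_le_one (fun n _ => Real.rpow_nonneg (hx n).1 _)
    fun n _ => Real.rpow_le_one (hx n).1 (hx n).2 (by positivity)

/-- Every utility is at most `1 ≤ w`, so every perturbed entry is at most `4 * w`. -/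
theorem NSW_perturb_of_one_le {N : ℕ} (hN : N ≠ 0) {x : Fin N → ℝ}
    (hx : ∀ n, x n ∈ Set.Icc (0 : ℝ) 1) {w : ℝ} (hw : 1 ≤ w) :
    NSW (fun n => (√(x n) + √w) ^ 2) ≤ 4 * w := by
  have h4 : ∏ _n : Fin N, (4 * w) ^ (1 / (N : ℝ)) = 4 * w := prod_rpow_one_div hN (by linarith)
  rw [← h4]
  refine NSW_mono (y := fun _ => 4 * w) (fun n => by positivity) fun n => ?_
  have h1 : √(x n) ≤ 1 := Real.sqrt_le_one.mpr (hx n).2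
  have h2 : 1 ≤ √w := Real.one_le_sqrt.mpr hw
  have h3 := Real.sq_sqrt (show 0 ≤ w by linarith)
  have h0 := Real.sqrt_nonneg (x n)
  nlinarith

/-- The single agent `m` already forces a factor `(4 * w) ^ (1 / N)`; each other factor is at most
`4 ^ (1 / N)`, and the `N` roots of 4 multiply to 4. -/
theorem NSW_perturb_of_exists_le {N : ℕ} (hN : N ≠ 0) {x : Fin N → ℝ}
    (hx : ∀ n, x n ∈ Set.Icc (0 : ℝ) 1) {w : ℝ} (hw0 : 0 ≤ w) (hw : w ≤ 1) {m : Fin N}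
    (hm : x m ≤ w) :
    NSW (fun n => (√(x n) + √w) ^ 2) ≤ 4 * w ^ (1 / (N : ℝ)) := by
  have h4 : ∏ _n : Fin N, (4 : ℝ) ^ (1 / (N : ℝ)) = 4 := prod_rpow_one_div hN (by norm_num)
  have h5 : ∏ n : Fin N, (if n = m then w ^ (1 / (N : ℝ)) else 1) = w ^ (1 / (N : ℝ)) := by
    simp
  rw [← h5]
  nth_rw 1 [← h4]
  rw [← Finset.prod_mul_distrib]
  refine Finset.prod_le_prod (fun n _ => by positivity) fun n _ => ?_
  have hN0 : (0 : ℝ) ≤ 1 / (N : ℝ) := by positivity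
  split_ifs with h
  · subst h
    rw [← Real.mul_rpow (by norm_num) hw0]
    refine Real.rpow_le_rpow (by positivity) ?_ hN0
    have h1 : √(x n) ≤ √w := Real.sqrt_le_sqrt hm
    have h3 := Real.sq_sqrt hw0
    have h0 := Real.sqrt_nonneg (x n)
    nlinarith
  · rw [mul_one]
    refine Real.rpow_le_rpow (by positivity) ?_ hN0
    have h1 : √(x n) ≤ 1 := Real.sqrt_le_one.mpr (hx n).2
    have h2 : √w ≤ 1 := Real.sqrt_le_one.mpr hw
    have h0 := Real.sqrt_nonneg (x n)
    have h0' := Real.sqrt_nonneg w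
    nlinarith

/-- From `1 - z ≤ exp (-z)` one gets `exp z ≤ 1 + z * exp z`, and `exp 2 ≤ 8`. -/
theorem exp_le_one_add_eight_mul {z : ℝ} (hz0 : 0 ≤ z) (hz : z ≤ 2) :
    Real.exp z ≤ 1 + 8 * z := by
  have h1 : Real.exp 2 ≤ 8 := by
    have h := Real.exp_one_lt_d9
    have h2 : Real.exp 2 = Real.exp 1 * Real.exp 1 := by rw [← Real.exp_add]; norm_num
    have := Real.exp_pos 1
    rw [h2]; nlinarith
  have h2 : Real.exp z ≤ 8 := (Real.exp_le_exp.mpr hz).trans h1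
  have h3 : 1 - z ≤ Real.exp (-z) := by linarith [Real.add_one_le_exp (-z)]
  have h4 : Real.exp (-z) * Real.exp z = 1 := by rw [← Real.exp_add]; simp
  have h5 := Real.exp_pos z
  nlinarith

/-- Here the perturbation is multiplicative: the welfare grows by at most `exp z`, with `z` an
average of the `2 * √(w / x n)`. Since `z ≤ 2`, the gain is at most `8 * NSW x * z`, and `NSW x ≤ x
n ^ (1 / N)` cancels the denominator in each term. -/
theorem NSW_perturb_of_forall_lt {N : ℕ} (hN : 2 ≤ N) {x : Fin N → ℝ}
    (hx : ∀ n, x n ∈ Set.Icc (0 : ℝ) 1) {w : ℝ} (hw0 : 0 ≤ w) (hw : ∀ n, w < x n) :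
    NSW (fun n => (√(x n) + √w) ^ 2) ≤ NSW x + 16 * w ^ (1 / (N : ℝ)) := by
  have hNr : (2 : ℝ) ≤ N := by exact_mod_cast hN
  have hpos : ∀ n, 0 < x n := fun n => hw0.trans_lt (hw n)
  have hratio : ∀ n, w / x n ∈ Set.Icc (0 : ℝ) 1 := fun n =>
    ⟨div_nonneg hw0 (hpos n).le, (div_le_one (hpos n)).mpr (hw n).le⟩
  set z : ℝ := ∑ n, 2 / (N : ℝ) * √(w / x n) with hz
  have hz0 : 0 ≤ z := Finset.sum_nonneg fun n _ => by positivity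
  have hcard : ∀ c : ℝ, ∑ _n : Fin N, 2 / (N : ℝ) * c = 2 * c := fun c => by
    simp; field_simp
  have hz2 : z ≤ 2 := by
    calc z ≤ ∑ _n : Fin N, 2 / (N : ℝ) * 1 := by
          refine Finset.sum_le_sum fun n _ => mul_le_mul_of_nonneg_left ?_ (by positivity)
          exact Real.sqrt_le_one.mpr (hratio n).2
      _ = 2 := by rw [hcard]; norm_num
  have hfac : NSW (fun n => (√(x n) + √w) ^ 2) ≤ NSW x * Real.exp z := by
    unfold NSW
    rw [hz, Real.exp_sum, ← Finset.prod_mul_distrib]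
    refine Finset.prod_le_prod (fun n _ => by positivity) fun n _ => ?_
    have h1 : (√(x n) + √w) ^ 2 = x n * (1 + √(w / x n)) ^ 2 := by
      rw [Real.sqrt_div hw0]
      have := Real.sqrt_pos.mpr (hpos n)
      have h2 := Real.sq_sqrt (hpos n).le
      nth_rw 2 [← h2]
      field_simp
    change ((√(x n) + √w) ^ 2) ^ (1 / (N : ℝ)) ≤ _
    rw [h1, Real.mul_rpow (hpos n).le (by positivity)]
    refine mul_le_mul_of_nonneg_left ?_ (Real.rpow_nonneg (hpos n).le _)
    calc ((1 + √(w / x n)) ^ 2) ^ (1 / (N : ℝ))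
        ≤ (Real.exp (√(w / x n)) ^ 2) ^ (1 / (N : ℝ)) := by
          gcongr
          linarith [Real.add_one_le_exp (√(w / x n))]
      _ = Real.exp (2 / (N : ℝ) * √(w / x n)) := by
          rw [← Real.exp_nat_mul, ← Real.exp_mul]
          congr 1; push_cast; ring
  have hG0 : 0 ≤ NSW x := NSW_nonneg fun n => (hx n).1
  have hGz : NSW x * z ≤ 2 * w ^ (1 / (N : ℝ)) := by
    rw [← hcard, hz, Finset.mul_sum]
    refine Finset.sum_le_sum fun n _ => ?_
    -- The ratio is at most 1 and `1 / N ≤ 1 / 2`; this is where `2 ≤ N` enters.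
    have h1 : √(w / x n) ≤ (w / x n) ^ (1 / (N : ℝ)) := by
      rw [Real.sqrt_eq_rpow]
      rcases (hratio n).1.eq_or_lt with h | h
      · rw [← h, Real.zero_rpow (by norm_num), Real.zero_rpow (by positivity)]
      · exact Real.rpow_le_rpow_of_exponent_ge h (hratio n).2
          (one_div_le_one_div_of_le (by norm_num) hNr)
    have h2 : NSW x * √(w / x n) ≤ w ^ (1 / (N : ℝ)) := by
      calc NSW x * √(w / x n) ≤ x n ^ (1 / (N : ℝ)) * (w / x n) ^ (1 / (N : ℝ)) :=
            mul_le_mul (NSW_le_rpow hx n) h1 (Real.sqrt_nonneg _)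
              (Real.rpow_nonneg (hpos n).le _)
        _ = w ^ (1 / (N : ℝ)) := by
            rw [← Real.mul_rpow (hpos n).le (hratio n).1, mul_div_cancel₀ _ (hpos n).ne']
    calc NSW x * (2 / (N : ℝ) * √(w / x n)) = 2 / (N : ℝ) * (NSW x * √(w / x n)) := by ring
      _ ≤ _ := mul_le_mul_of_nonneg_left h2 (by positivity)
  calc _ ≤ NSW x * Real.exp z := hfac
    _ ≤ NSW x * (1 + 8 * z) :=
        mul_le_mul_of_nonneg_left (exp_le_one_add_eight_mul hz0 hz2) hG0
    _ = NSW x + 8 * (NSW x * z) := by ring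
    _ ≤ _ := by linarith

/-- Hölder-type stability of the welfare under a perturbation of the square roots of all utilities.
The constant does not depend on the number of agents. -/
theorem NSW_perturb {N : ℕ} (hN : 2 ≤ N) {x : Fin N → ℝ}
    (hx : ∀ n, x n ∈ Set.Icc (0 : ℝ) 1) {w : ℝ} (hw0 : 0 ≤ w) :
    NSW (fun n => (√(x n) + √w) ^ 2) ≤ NSW x + 16 * (w ^ (1 / (N : ℝ)) + w) := by
  have hG0 : 0 ≤ NSW x := NSW_nonneg fun n => (hx n).1
  have hr : 0 ≤ w ^ (1 / (N : ℝ)) := Real.rpow_nonneg hw0 _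
  rcases le_total 1 w with h1 | h1
  · linarith [NSW_perturb_of_one_le (by omega) hx h1]
  by_cases h : ∃ m, x m ≤ w
  · obtain ⟨m, hm⟩ := h
    linarith [NSW_perturb_of_exists_le (by omega) hx hw0 h1 hm]
  · push Not at h
    linarith [NSW_perturb_of_forall_lt hN hx hw0 h]

/-- Replaces the concave power by an affine function of `w`, so that expectations and sums over
rounds pass through. The first term covers `w ≤ a`; for `w ≥ a`, the power `w ^ (β - 1)` is at most
`a ^ (β - 1)`. -/
theorem rpow_le_add_mul {a w β : ℝ} (ha : 0 < a) (hw : 0 ≤ w) (hβ0 : 0 ≤ β) (hβ : β ≤ 1) :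
    w ^ β ≤ a ^ β + a ^ (β - 1) * w := by
  rcases le_total w a with h | h
  · have h1 := Real.rpow_le_rpow hw h hβ0
    have h2 : 0 ≤ a ^ (β - 1) * w := mul_nonneg (Real.rpow_nonneg ha.le _) hw
    linarith
  · have hwp : 0 < w := ha.trans_le h
    have h1 : w ^ β = w ^ (β - 1) * w := by
      rw [Real.rpow_sub_one hwp.ne', div_mul_cancel₀ _ hwp.ne']
    have h2 : w ^ (β - 1) ≤ a ^ (β - 1) := Real.rpow_le_rpow_of_nonpos ha h (by linarith)
    have h3 := mul_le_mul_of_nonneg_right h2 hw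
    have h4 := Real.rpow_nonneg ha.le β
    linarith

/-! ### Welfare of strategies -/

theorem expectedUtility_mem_Icc {K N : ℕ} {u : Fin K → Fin N → ℝ}
    (hu : ∀ i n, u i n ∈ Set.Icc (0 : ℝ) 1) {p : Fin K → ℝ} (hp : p ∈ stdSimplex ℝ (Fin K))
    (n : Fin N) : expectedUtility u p n ∈ Set.Icc (0 : ℝ) 1 := by
  refine ⟨Finset.sum_nonneg fun i _ => mul_nonneg (hp.1 i) (hu i n).1, ?_⟩
  rw [← hp.2]
  exact Finset.sum_le_sum fun i _ => mul_le_of_le_one_right (hp.1 i) (hu i n).2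

theorem welfare_mem_Icc {K N : ℕ} {u : Fin K → Fin N → ℝ}
    (hu : ∀ i n, u i n ∈ Set.Icc (0 : ℝ) 1) {p : Fin K → ℝ} (hp : p ∈ stdSimplex ℝ (Fin K)) :
    welfare u p ∈ Set.Icc (0 : ℝ) 1 :=
  ⟨NSW_nonneg fun n => (expectedUtility_mem_Icc hu hp n).1,
    NSW_le_one fun n => expectedUtility_mem_Icc hu hp n⟩

theorem welfare_mono {K N : ℕ} {u v : Fin K → Fin N → ℝ} (hu : ∀ i n, 0 ≤ u i n)
    (huv : ∀ i n, u i n ≤ v i n) {p : Fin K → ℝ} (hp : ∀ i, 0 ≤ p i) :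
    welfare u p ≤ welfare v p :=
  NSW_mono (fun n => Finset.sum_nonneg fun i _ => mul_nonneg (hp i) (hu i n))
    fun n => Finset.sum_le_sum fun i _ => mul_le_mul_of_nonneg_left (huv i n) (hp i)

/-- Minkowski's inequality in L²(p) for `√f` and `√g`: after expanding, only the cross term needs
Cauchy–Schwarz. -/
theorem sum_mul_sqrt_add_sqrt_sq_le {ι : Type*} [Fintype ι] {p f g : ι → ℝ} (hp : ∀ i, 0 ≤ p i)
    (hf : ∀ i, 0 ≤ f i) (hg : ∀ i, 0 ≤ g i) :
    ∑ i, p i * (√(f i) + √(g i)) ^ 2 ≤ (√(∑ i, p i * f i) + √(∑ i, p i * g i)) ^ 2 := by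
  have h1 : ∑ i, √(p i * f i) * √(p i * g i) ≤ √(∑ i, p i * f i) * √(∑ i, p i * g i) :=
    Real.sum_sqrt_mul_sqrt_le _ (fun i => mul_nonneg (hp i) (hf i))
      fun i => mul_nonneg (hp i) (hg i)
  have h2 : ∑ i, p i * (√(f i) + √(g i)) ^ 2
      = ∑ i, p i * f i + ∑ i, p i * g i + 2 * ∑ i, √(p i * f i) * √(p i * g i) := by
    rw [Finset.mul_sum, ← Finset.sum_add_distrib, ← Finset.sum_add_distrib]
    refine Finset.sum_congr rfl fun i _ => ?_
    rw [Real.sqrt_mul (hp i), Real.sqrt_mul (hp i)]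
    have hpp := Real.mul_self_sqrt (hp i)
    have hff := Real.mul_self_sqrt (hf i)
    have hgg := Real.mul_self_sqrt (hg i)
    linear_combination p i * hff + p i * hgg - 2 * √(f i) * √(g i) * hpp
  have h3 := Real.sq_sqrt (Finset.sum_nonneg fun i _ => mul_nonneg (hp i) (hf i) :
    0 ≤ ∑ i, p i * f i)
  have h4 := Real.sq_sqrt (Finset.sum_nonneg fun i _ => mul_nonneg (hp i) (hg i) :
    0 ≤ ∑ i, p i * g i)
  rw [h2]; nlinarith

/-- Optimism: the loss of a maximizer of an upper bound `û` of `u` is controlled by the average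
squared width of `û`. -/
theorem welfare_sub_le_of_isMaxOn {K N : ℕ} (hN : 2 ≤ N) {u û : Fin K → Fin N → ℝ} {g : Fin K → ℝ}
    (hu : ∀ i n, u i n ∈ Set.Icc (0 : ℝ) 1) (hlow : ∀ i n, u i n ≤ û i n) (hg : ∀ i, 0 ≤ g i)
    (hup : ∀ i n, û i n ≤ (√(u i n) + √(g i)) ^ 2) {p q : Fin K → ℝ}
    (hp : p ∈ stdSimplex ℝ (Fin K)) (hq : q ∈ stdSimplex ℝ (Fin K))
    (hmax : IsMaxOn (welfare û) (stdSimplex ℝ (Fin K)) p) {a : ℝ} (ha : 0 < a) :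
    welfare u q - welfare u p ≤ 16 * (a ^ (1 / (N : ℝ))
      + (a ^ (1 / (N : ℝ) - 1) + 1) * ∑ i, p i * g i) := by
  have hNr : (2 : ℝ) ≤ N := by exact_mod_cast hN
  have hw : 0 ≤ ∑ i, p i * g i := Finset.sum_nonneg fun i _ => mul_nonneg (hp.1 i) (hg i)
  have h1 : welfare u q ≤ welfare û q := welfare_mono (fun i n => (hu i n).1) hlow hq.1
  have h2 : welfare û q ≤ welfare û p := hmax hq
  have h3 : welfare û p ≤
      NSW (fun n => (√(expectedUtility u p n) + √(∑ i, p i * g i)) ^ 2) := by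
    refine NSW_mono (fun n => Finset.sum_nonneg fun i _ =>
      mul_nonneg (hp.1 i) ((hu i n).1.trans (hlow i n))) fun n => ?_
    refine (Finset.sum_le_sum fun i _ => mul_le_mul_of_nonneg_left (hup i n) (hp.1 i)).trans ?_
    exact sum_mul_sqrt_add_sqrt_sq_le hp.1 (fun i => (hu i n).1) hg
  have h4 := NSW_perturb hN (fun n => expectedUtility_mem_Icc hu hp n) hw
  have h5 := rpow_le_add_mul (β := 1 / (N : ℝ)) ha hw (by positivity)
    (by rw [div_le_one (by linarith)]; linarith)
  have h6 : welfare u p = NSW (expectedUtility u p) := rfl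
  rw [h6]
  nlinarith

/-! ### Pull counts -/

theorem pullCount_eq_sum {K : ℕ} (a : ℕ → Fin K) (t : ℕ) (i : Fin K) :
    pullCount a t i = ∑ τ ∈ Finset.Icc 1 t, if a τ = i then 1 else 0 :=
  Finset.card_filter _ _

theorem pullCount_succ {K : ℕ} (a : ℕ → Fin K) (t : ℕ) (i : Fin K) :
    pullCount a (t + 1) i = pullCount a t i + if a (t + 1) = i then 1 else 0 := by
  rw [pullCount_eq_sum, pullCount_eq_sum, Finset.sum_Icc_succ_top (by omega)]

theorem pullCount_le {K : ℕ} (a : ℕ → Fin K) (t : ℕ) (i : Fin K) : pullCount a t i ≤ t := by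
  simpa [pullCount] using Finset.card_filter_le (Finset.Icc 1 t) fun τ => a τ = i

theorem sum_range_inv_max_one_le (m : ℕ) :
    ∑ s ∈ Finset.range m, (1 : ℝ) / max (s : ℝ) 1 ≤ 2 + Real.log m := by
  cases m with
  | zero => simp
  | succ m =>
    -- The term `s = 0` equals 1 because of the `max`; the rest is a harmonic sum.
    rw [Finset.sum_range_succ']
    have h1 : ∑ s ∈ Finset.range m, (1 : ℝ) / max ((s + 1 : ℕ) : ℝ) 1 = (harmonic m : ℝ) := by
      rw [harmonic]; push_cast
      refine Finset.sum_congr rfl fun s _ => ?_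
      rw [max_eq_left (by linarith [Nat.cast_nonneg (α := ℝ) s]), one_div]
    have h2 := harmonic_le_one_add_log m
    have h3 : Real.log m ≤ Real.log ((m + 1 : ℕ) : ℝ) := by
      rcases Nat.eq_zero_or_pos m with rfl | hm
      · simp
      · exact Real.log_le_log (by exact_mod_cast hm) (by push_cast; linarith)
    rw [h1]
    norm_num at h3 ⊢
    linarith

/-- Regroup the rounds by arm: the successive pulls of an arm see the counts 0, 1, 2, …, so each arm
contributes a harmonic sum of length at most `T`. -/
theorem sum_inv_max_pullCount_le {K : ℕ} (a : ℕ → Fin K) (T : ℕ) :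
    ∑ t ∈ Finset.range T, (1 : ℝ) / max (pullCount a t (a (t + 1)) : ℝ) 1
      ≤ K * (2 + Real.log T) := by
  have h1 : ∀ T, ∑ t ∈ Finset.range T, (1 : ℝ) / max (pullCount a t (a (t + 1)) : ℝ) 1
      = ∑ i, ∑ s ∈ Finset.range (pullCount a T i), (1 : ℝ) / max (s : ℝ) 1 := by
    intro T
    induction T with
    | zero => simp [pullCount]
    | succ T ih =>
      rw [Finset.sum_range_succ, ih]
      have h2 : ∀ i, ∑ s ∈ Finset.range (pullCount a (T + 1) i), (1 : ℝ) / max (s : ℝ) 1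
          = ∑ s ∈ Finset.range (pullCount a T i), (1 : ℝ) / max (s : ℝ) 1
            + if a (T + 1) = i then (1 : ℝ) / max (pullCount a T i : ℝ) 1 else 0 := by
        intro i
        rw [pullCount_succ]
        split_ifs
        · rw [Finset.sum_range_succ]
        · simp
      simp_rw [h2]
      rw [Finset.sum_add_distrib, Finset.sum_ite_eq]
      simp
  rw [h1]
  calc _ ≤ ∑ _i : Fin K, (2 + Real.log T) := by
        refine Finset.sum_le_sum fun i _ => le_trans ?_ (sum_range_inv_max_one_le T)
        refine Finset.sum_le_sum_of_subset_of_nonneg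
          (Finset.range_mono (pullCount_le a T i)) fun s _ _ => by positivity
    _ = _ := by rw [Finset.sum_const, Finset.card_univ, Fintype.card_fin, nsmul_eq_mul]

/-! ### Deterministic confidence bounds -/

/-- The exponent of the supermartingale which controls the deviation of the rewards of arm `i` for
agent `n` from the mean `c`. -/
noncomputable def logWealth {K N : ℕ} (lam c : ℝ) (a : ℕ → Fin K) (v : ℕ → Fin K → Fin N → ℝ) (t : ℕ)
    (i : Fin K) (n : Fin N) : ℝ :=
  ∑ τ ∈ Finset.Icc 1 t, if a τ = i then lam * (v τ i n - c) - lam ^ 2 * c else 0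

theorem logWealth_succ {K N : ℕ} (lam c : ℝ) (a : ℕ → Fin K) (v : ℕ → Fin K → Fin N → ℝ) (t : ℕ)
    (i : Fin K) (n : Fin N) :
    logWealth lam c a v (t + 1) i n = logWealth lam c a v t i n
      + if a (t + 1) = i then lam * (v (t + 1) i n - c) - lam ^ 2 * c else 0 :=
  Finset.sum_Icc_succ_top (by omega) _

theorem logWealth_eq {K N : ℕ} (lam c : ℝ) (a : ℕ → Fin K) (v : ℕ → Fin K → Fin N → ℝ) (t : ℕ)
    (i : Fin K) (n : Fin N) (h : pullCount a t i ≠ 0) :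
    logWealth lam c a v t i n = pullCount a t i *
      (lam * (empiricalMean a v t i n - c) - lam ^ 2 * c) := by
  have h' : (pullCount a t i : ℝ) ≠ 0 := by exact_mod_cast h
  have h1 : pullCount a t i * empiricalMean a v t i n
      = ∑ τ ∈ Finset.Icc 1 t, if a τ = i then v τ i n else 0 := by
    rw [empiricalMean, mul_div_cancel₀ _ h']
  have h2 : (pullCount a t i : ℝ) = ∑ τ ∈ Finset.Icc 1 t, if a τ = i then 1 else 0 := by
    rw [pullCount_eq_sum]; push_cast; rfl
  have h3 : pullCount a t i * (lam * (empiricalMean a v t i n - c) - lam ^ 2 * c)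
      = lam * (pullCount a t i * empiricalMean a v t i n)
        - (lam * c + lam ^ 2 * c) * pullCount a t i := by ring
  rw [h3, h1, h2, Finset.mul_sum, Finset.mul_sum, ← Finset.sum_sub_distrib]
  refine Finset.sum_congr rfl fun τ _ => ?_
  split_ifs <;> ring

/-- The tuning of `logWealth` for `s` samples with mean `c` at confidence `exp (-2 * L)`. -/
noncomputable def deviationRate (L c : ℝ) (s : ℕ) : ℝ :=
  -- The minimizer of `2 * L / (lam * s) + lam * c`, the deviation excluded by `logWealth < 2 * L`,
  -- truncated at 1 because the exponential moment bound needs `|lam| ≤ 1`.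
  if c * s ≤ 2 * L then 1 else √(2 * L / (c * s))

theorem deviationRate_nonneg (L c : ℝ) (s : ℕ) : 0 ≤ deviationRate L c s := by
  unfold deviationRate; split_ifs <;> positivity

theorem deviationRate_le_one {L c : ℝ} (hL : 0 ≤ L) (s : ℕ) : deviationRate L c s ≤ 1 := by
  unfold deviationRate
  split_ifs with h
  · exact le_rfl
  · push Not at h
    exact Real.sqrt_le_one.mpr ((div_le_one (by linarith)).mpr h.le)

/-- The confidence bounds in terms of square roots: `x`, `y`, `g` stand for the roots of the mean, of
the empirical mean and of the width parameter. -/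
theorem sqrt_confidence {x y g : ℝ} (hx : 0 ≤ x) (hy : 0 ≤ y) (hg : 0 ≤ g)
    (hup : y ^ 2 ≤ (x + 2 * g) ^ 2) (hlow : x ^ 2 ≤ 2 * g ^ 2 ∨ x ^ 2 - y ^ 2 ≤ 2 * √2 * (x * g)) :
    x ^ 2 ≤ y ^ 2 + 4 * (y * g) + 8 * g ^ 2 ∧
      y ^ 2 + 4 * (y * g) + 8 * g ^ 2 ≤ (x + 5 * g) ^ 2 := by
  have hxg := mul_nonneg hx hg
  have hyg := mul_nonneg hy hg
  constructor
  · rcases hlow with h | h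
    · nlinarith
    · have hk : (2 * √2) ^ 2 = (8 : ℝ) := by
        rw [mul_pow, Real.sq_sqrt (by norm_num)]; norm_num
      set k : ℝ := 2 * √2
      have hk0 : 0 ≤ k := by positivity
      have hk3 : k ≤ 3 := by nlinarith
      have hkg : 0 ≤ k * g := mul_nonneg hk0 hg
      -- Inserting this bound into `x² - y² ≤ k * g * x` gives `y² + k * y * g + 8 * g²`, and `k ≤
      -- 3` suffices.
      have h1 : x ≤ y + k * g := by
        by_contra! hlt
        nlinarith [mul_nonneg hx hkg]
      have h2 : k * g * x ≤ k * g * (y + k * g) := mul_le_mul_of_nonneg_left h1 hkg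
      have h3 : k * g * (k * g) = 8 * g ^ 2 := by rw [← hk]; ring
      nlinarith [mul_le_mul_of_nonneg_right hk3 hyg]
  -- The width is `(y + 2 * g)² + 4 * g²`, hence at most `(x + 4 * g)² + 4 * g² ≤ (x + 5 * g)²`.
  · have h1 : y ≤ x + 2 * g := abs_le_of_sq_le_sq' hup (by positivity) |>.2
    nlinarith

/-- If no deviation of size `exp (2 * L)` occurs, the width-`L` confidence bounds hold. -/
theorem confidence_of_logWealth_lt {K N : ℕ} {L c : ℝ} (hL : 0 < L) (hc : 0 ≤ c) {a : ℕ → Fin K}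
    {v : ℕ → Fin K → Fin N → ℝ} {t : ℕ} {i : Fin K} {n : Fin N}
    (hmean : 0 ≤ empiricalMean a v t i n) (hs : pullCount a t i ≠ 0)
    (hplus : logWealth (deviationRate L c (pullCount a t i)) c a v t i n < 2 * L)
    (hminus : logWealth (-deviationRate L c (pullCount a t i)) c a v t i n < 2 * L) :
    c ≤ empiricalMean a v t i n + 4 * √(empiricalMean a v t i n * L / pullCount a t i)
        + 8 * L / pullCount a t i ∧
      empiricalMean a v t i n + 4 * √(empiricalMean a v t i n * L / pullCount a t i)
        + 8 * L / pullCount a t i ≤ (√c + √(25 * L / pullCount a t i)) ^ 2 := by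
  rw [logWealth_eq _ _ _ _ _ _ _ hs] at hplus hminus
  set e := empiricalMean a v t i n
  set s := pullCount a t i
  have hs' : (0 : ℝ) < s := by exact_mod_cast Nat.pos_of_ne_zero hs
  have hq : 0 ≤ L / s := by positivity
  have hc2 := Real.sq_sqrt hc
  have he2 := Real.sq_sqrt hmean
  have hg2 := Real.sq_sqrt hq
  have hxg := mul_nonneg (Real.sqrt_nonneg c) (Real.sqrt_nonneg (L / s))
  have key := sqrt_confidence (Real.sqrt_nonneg c) (Real.sqrt_nonneg e)
    (Real.sqrt_nonneg (L / s))
  rw [hc2, he2, hg2] at key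
  have h25 : √(25 * L / s) = 5 * √(L / s) := by
    rw [mul_div_assoc, Real.sqrt_mul (by norm_num), show (25 : ℝ) = 5 ^ 2 by norm_num,
      Real.sqrt_sq (by norm_num)]
  have hsq : √(e * L / s) = √e * √(L / s) := by rw [mul_div_assoc, Real.sqrt_mul hmean]
  have h8 : 8 * L / s = 8 * (L / s) := mul_div_assoc _ _ _
  rw [h25, hsq, h8]
  unfold deviationRate at hplus hminus
  split_ifs at hplus hminus with h
  -- Small mean, `lam = 1`: the lower bound is trivial and only the upper tail is used.
  · have h1 : c ≤ 2 * (L / s) := by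
      rw [← mul_div_assoc, le_div_iff₀ hs']; exact h
    refine key ?_ (Or.inl h1)
    have h2 : e < 2 * c + 2 * (L / s) := by
      have : s * (e - 2 * c) < s * (2 * (L / s)) := by
        calc s * (e - 2 * c) = s * (1 * (e - c) - 1 ^ 2 * c) := by ring
          _ < 2 * L := hplus
          _ = _ := by field_simp
      have := lt_of_mul_lt_mul_left this hs'.le
      linarith
    nlinarith
  · push Not at h
    have hcs : 0 < c * s := by linarith
    have hcpos : 0 < c := pos_of_mul_pos_left hcs hs'.le
    have hx : 0 < √c := Real.sqrt_pos.mpr hcpos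
    have hg : 0 < √(L / s) := Real.sqrt_pos.mpr (by positivity)
    have hlam : √(2 * L / (c * s)) = √2 * √(L / s) / √c := by
      rw [show 2 * L / (c * s) = 2 * (L / s) / c by field_simp, Real.sqrt_div (by positivity),
        Real.sqrt_mul (by norm_num)]
    have hlam0 : 0 < √2 * √(L / s) / √c := by positivity
    have h2 : √2 ^ 2 = (2 : ℝ) := Real.sq_sqrt (by norm_num)
    rw [hlam] at hplus hminus
    set lam := √2 * √(L / s) / √c with hlam_def
    have hlc : lam * c = √2 * (√c * √(L / s)) := by
      rw [hlam_def]; nth_rw 2 [← hc2]; field_simp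
    have hls : lam * (lam * c) * s = 2 * L := by
      rw [hlc, hlam_def]
      have : √2 * √(L / s) / √c * (√2 * (√c * √(L / s))) = √2 ^ 2 * √(L / s) ^ 2 := by
        field_simp
      rw [this, h2, hg2]; field_simp
    -- The tuning makes `lam ^ 2 * c * s = 2 * L`, so both tails are at most `2 * lam * c`.
    have hbound : ∀ d : ℝ, s * (lam * d - lam ^ 2 * c) < 2 * L →
        d ≤ 2 * √2 * (√c * √(L / s)) := by
      intro d hd
      have h3 : lam * s * d < lam * s * (2 * (lam * c)) := by nlinarith
      have h4 := lt_of_mul_lt_mul_left h3 (by positivity)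
      rw [hlc] at h4
      linarith
    have hp := hbound (e - c) hplus
    have hm := hbound (c - e) (by
      calc s * (lam * (c - e) - lam ^ 2 * c) = s * (-lam * (e - c) - (-lam) ^ 2 * c) := by ring
        _ < _ := hminus)
    refine key ?_ (Or.inr hm)
    have h3 : √2 ≤ 2 := by nlinarith [Real.sqrt_nonneg 2]
    nlinarith [mul_le_mul_of_nonneg_right h3 hxg]

/-! ### Concentration -/

theorem integrable_of_ae_mem_Icc {α : Type*} [MeasurableSpace α] {μ : Measure α}
    [IsFiniteMeasure μ] {f : α → ℝ} (hf : Measurable f) (h : ∀ᵐ x ∂μ, f x ∈ Set.Icc (0 : ℝ) 1) :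
    Integrable f μ := by
  refine Integrable.of_bound hf.aestronglyMeasurable 1 ?_
  filter_upwards [h] with x hx
  rw [Real.norm_eq_abs, abs_le]
  exact ⟨by linarith [hx.1], hx.2⟩

theorem integral_mem_Icc {α : Type*} [MeasurableSpace α] {μ : Measure α}
    [IsProbabilityMeasure μ] {f : α → ℝ} (hf : Measurable f)
    (h : ∀ᵐ x ∂μ, f x ∈ Set.Icc (0 : ℝ) 1) : ∫ x, f x ∂μ ∈ Set.Icc (0 : ℝ) 1 := by
  refine ⟨integral_nonneg_of_ae (h.mono fun x hx => hx.1), ?_⟩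
  have := integral_mono_ae (integrable_of_ae_mem_Icc hf h) (integrable_const 1)
    (h.mono fun x hx => hx.2)
  simpa using this

/-- A sub-Poissonian bound for random variables in `[0, 1]`, valid for both tails. -/
theorem lintegral_exp_deviation_le_one {α : Type*} [MeasurableSpace α] {μ : Measure α}
    [IsProbabilityMeasure μ] {f : α → ℝ} (hf : Measurable f)
    (h : ∀ᵐ x ∂μ, f x ∈ Set.Icc (0 : ℝ) 1) {lam : ℝ} (hlam : |lam| ≤ 1) :
    ∫⁻ x, ENNReal.ofReal (Real.exp (lam * (f x - ∫ y, f y ∂μ) - lam ^ 2 * ∫ y, f y ∂μ)) ∂μ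
      ≤ 1 := by
  set c := ∫ y, f y ∂μ with hc
  have hfi := integrable_of_ae_mem_Icc hf h
  -- `exp x ≤ 1 + x + x²` for `|x| ≤ 1`, and `y² ≤ y`; the variance is thus replaced by the mean,
  -- for either sign of `lam`.
  have hpt : ∀ y ∈ Set.Icc (0 : ℝ) 1, Real.exp (lam * y) ≤ 1 + (lam + lam ^ 2) * y := by
    intro y hy
    have h1 : |lam * y| ≤ 1 := by
      rw [abs_mul, abs_of_nonneg hy.1]
      exact mul_le_one₀ hlam hy.1 hy.2
    have h2 := (abs_le.mp (Real.abs_exp_sub_one_sub_id_le h1)).2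
    have h3 : lam ^ 2 * (y * y) ≤ lam ^ 2 * y :=
      mul_le_mul_of_nonneg_left (by nlinarith [hy.1, hy.2]) (sq_nonneg _)
    nlinarith
  have hsplit : ∀ y, Real.exp (lam * (y - c) - lam ^ 2 * c)
      = Real.exp (-((lam + lam ^ 2) * c)) * Real.exp (lam * y) := fun y => by
    rw [← Real.exp_add]; ring_nf
  have hint : Integrable (fun x => Real.exp (-((lam + lam ^ 2) * c))
      * (1 + (lam + lam ^ 2) * f x)) μ :=
    ((integrable_const 1).add (hfi.const_mul _)).const_mul _
  calc _ ≤ ∫⁻ x, ENNReal.ofReal (Real.exp (-((lam + lam ^ 2) * c))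
            * (1 + (lam + lam ^ 2) * f x)) ∂μ := by
        refine lintegral_mono_ae (h.mono fun x hx => ENNReal.ofReal_le_ofReal ?_)
        rw [hsplit]
        exact mul_le_mul_of_nonneg_left (hpt _ hx) (Real.exp_pos _).le
    _ = ENNReal.ofReal (∫ x, Real.exp (-((lam + lam ^ 2) * c))
            * (1 + (lam + lam ^ 2) * f x) ∂μ) := by
        refine (ofReal_integral_eq_lintegral_ofReal hint (h.mono fun x hx => ?_)).symm
        exact mul_nonneg (Real.exp_pos _).le ((Real.exp_pos _).le.trans (hpt _ hx))
    _ ≤ 1 := by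
        rw [integral_const_mul, integral_add (integrable_const 1) (hfi.const_mul _),
          integral_const_mul, ← hc]
        rw [← ENNReal.ofReal_one]
        refine ENNReal.ofReal_le_ofReal ?_
        have h1 := Real.add_one_le_exp ((lam + lam ^ 2) * c)
        have h2 : Real.exp (-((lam + lam ^ 2) * c)) * Real.exp ((lam + lam ^ 2) * c) = 1 := by
          rw [← Real.exp_add]; simp
        have h3 := mul_le_mul_of_nonneg_left h1 (Real.exp_pos (-((lam + lam ^ 2) * c))).le
        simp only [integral_const, probReal_univ, smul_eq_mul, mul_one]
        linarith

variable {Ω : Type*} {mΩ : MeasurableSpace Ω} {K N T : ℕ} {ν : Measure (Fin K → Fin N → ℝ)}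
  {μ : Measure Ω} {ℱ : Filtration ℕ mΩ} {U : ℕ → Ω → Fin K → Fin N → ℝ}
  {p : ℕ → Ω → Fin K → ℝ} {I : ℕ → Ω → Fin K}

theorem measurable_utility_entry (i : Fin K) (n : Fin N) :
    Measurable fun v : Fin K → Fin N → ℝ => v i n :=
  (measurable_pi_apply n).comp (measurable_pi_apply i)

theorem IsBanditInteraction.measurable_utility (h : IsBanditInteraction T ν μ ℱ U p I) {τ t : ℕ}
    (hτ : τ ∈ Finset.Icc 1 t) (ht : t ≤ T) : Measurable[ℱ t] (U τ) := by
  obtain ⟨h1, h2⟩ := Finset.mem_Icc.mp hτ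
  obtain ⟨τ, rfl⟩ : ∃ σ, τ = σ + 1 := ⟨τ - 1, by omega⟩
  exact (h.utility_measurable τ (by omega)).mono (ℱ.mono h2) le_rfl

theorem IsBanditInteraction.measurableSet_arm_eq (h : IsBanditInteraction T ν μ ℱ U p I) {τ t : ℕ}
    (hτ : τ ∈ Finset.Icc 1 t) (ht : t ≤ T) (i : Fin K) :
    MeasurableSet[ℱ t] {ω | I τ ω = i} := by
  obtain ⟨h1, h2⟩ := Finset.mem_Icc.mp hτ
  obtain ⟨τ, rfl⟩ : ∃ σ, τ = σ + 1 := ⟨τ - 1, by omega⟩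
  exact ℱ.mono h2 _ (h.arm_measurable τ (by omega) (measurableSet_singleton i))

theorem IsBanditInteraction.measurable_pullCount (h : IsBanditInteraction T ν μ ℱ U p I) {t : ℕ}
    (ht : t ≤ T) (i : Fin K) : Measurable[ℱ t] fun ω => pullCount (fun τ => I τ ω) t i := by
  simp_rw [pullCount_eq_sum]
  refine Finset.measurable_sum _ fun τ hτ => ?_
  exact Measurable.ite (h.measurableSet_arm_eq hτ ht i) measurable_const measurable_const

theorem IsBanditInteraction.measurable_logWealth (h : IsBanditInteraction T ν μ ℱ U p I) {t : ℕ}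
    (ht : t ≤ T) (lam c : ℝ) (i : Fin K) (n : Fin N) :
    Measurable[ℱ t] fun ω => logWealth lam c (fun τ => I τ ω) (fun τ => U τ ω) t i n := by
  unfold logWealth
  refine Finset.measurable_sum _ fun τ hτ => ?_
  have hU : Measurable[ℱ t] fun ω => U τ ω i n :=
    (measurable_utility_entry i n).comp (h.measurable_utility hτ ht)
  exact Measurable.ite (h.measurableSet_arm_eq hτ ht i)
    (((hU.sub_const c).const_mul lam).sub_const _) measurable_const

/-- Supermartingale step: if arm `i` is selected, the wealth is multiplied by a factor of mean at
most 1 that is independent of the past and of the selection; otherwise it is unchanged. -/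
theorem IsBanditInteraction.lintegral_exp_logWealth_le_one [IsProbabilityMeasure ν]
    [IsProbabilityMeasure μ] (h : IsBanditInteraction T ν μ ℱ U p I)
    (hν : ∀ᵐ v ∂ν, ∀ i n, v i n ∈ Set.Icc (0 : ℝ) 1) {lam : ℝ} (hlam : |lam| ≤ 1) (i : Fin K)
    (n : Fin N) {t : ℕ} (ht : t ≤ T) :
    ∫⁻ ω, ENNReal.ofReal (Real.exp (logWealth lam (meanUtility ν i n) (fun τ => I τ ω)
      (fun τ => U τ ω) t i n)) ∂μ ≤ 1 := by
  induction t with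
  | zero => simp [logWealth]
  | succ t ih =>
    set c := meanUtility ν i n with hc
    set M : Ω → ENNReal := fun ω => ENNReal.ofReal (Real.exp (logWealth lam c (fun τ => I τ ω)
      (fun τ => U τ ω) t i n)) with hM
    set ψ : (Fin K → Fin N → ℝ) → ENNReal :=
      fun v => ENNReal.ofReal (Real.exp (lam * (v i n - c) - lam ^ 2 * c)) with hψ
    set A : Set Ω := {ω | I (t + 1) ω = i} with hA
    have htT : t < T := by omega
    have hmM : Measurable[ℱ t] M :=
      ENNReal.measurable_ofReal.comp
        (Real.measurable_exp.comp (h.measurable_logWealth htT.le lam c i n))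
    have hmψ : Measurable ψ := by
      refine ENNReal.measurable_ofReal.comp (Real.measurable_exp.comp ?_)
      exact (((measurable_utility_entry i n).sub_const c).const_mul lam).sub_const _
    have hmA : MeasurableSet[MeasurableSpace.comap (I (t + 1)) inferInstance] A :=
      ⟨{i}, measurableSet_singleton i, rfl⟩
    have hI : Measurable (I (t + 1)) := (h.arm_measurable t htT).mono (ℱ.le _) le_rfl
    have hmA' : MeasurableSet A := hI (measurableSet_singleton i)
    have hmU : Measurable (U (t + 1)) := (h.utility_measurable t htT).mono (ℱ.le _) le_rfl
    have hψ1 : ∫⁻ ω, ψ (U (t + 1) ω) ∂μ ≤ 1 := by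
      rw [(h.utility_law t htT).lintegral_comp hmψ.aemeasurable]
      exact lintegral_exp_deviation_le_one (measurable_utility_entry i n)
        (hν.mono fun v hv => hv i n) hlam
    have hstep : ∀ ω, ENNReal.ofReal (Real.exp (logWealth lam c (fun τ => I τ ω)
        (fun τ => U τ ω) (t + 1) i n))
        = A.indicator M ω * ψ (U (t + 1) ω) + Aᶜ.indicator M ω := by
      intro ω
      rw [logWealth_succ]
      by_cases hω : I (t + 1) ω = i
      · have h1 : ω ∈ A := hω
        have h2 : ω ∉ Aᶜ := fun h => h h1
        rw [Set.indicator_of_mem h1, Set.indicator_of_notMem h2, if_pos hω, Real.exp_add,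
          ENNReal.ofReal_mul (Real.exp_pos _).le, add_zero]
      · have h1 : ω ∉ A := hω
        have h2 : ω ∈ Aᶜ := h1
        rw [Set.indicator_of_mem h2, Set.indicator_of_notMem h1, if_neg hω, zero_mul, zero_add,
          add_zero]
    have hle : ℱ t ⊔ MeasurableSpace.comap (I (t + 1)) inferInstance ≤ mΩ :=
      sup_le (ℱ.le t) hI.comap_le
    have hmMA : Measurable[ℱ t ⊔ MeasurableSpace.comap (I (t + 1)) inferInstance]
        (A.indicator M) :=
      (hmM.mono le_sup_left le_rfl).indicator ((le_sup_right :
        MeasurableSpace.comap (I (t + 1)) inferInstance ≤ _) _ hmA)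
    have hind := lintegral_mul_eq_lintegral_mul_lintegral_of_independent_measurableSpace
      hle hmU.comap_le (h.utility_indep t htT).symm hmMA
      (hmψ.comp (comap_measurable (U (t + 1))))
    have hmM' : Measurable M := hmM.mono (ℱ.le t) le_rfl
    simp_rw [hstep]
    rw [lintegral_add_right _ (hmM'.indicator hmA'.compl)]
    calc _ = (∫⁻ ω, A.indicator M ω ∂μ) * ∫⁻ ω, ψ (U (t + 1) ω) ∂μ
            + ∫⁻ ω, Aᶜ.indicator M ω ∂μ :=
          congrArg (· + ∫⁻ ω, Aᶜ.indicator M ω ∂μ) hind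
      _ ≤ ∫⁻ ω, A.indicator M ω ∂μ + ∫⁻ ω, Aᶜ.indicator M ω ∂μ := by
          gcongr
          exact mul_le_of_le_one_right zero_le hψ1
      _ = ∫⁻ ω, M ω ∂μ := by
          rw [lintegral_indicator hmA', lintegral_indicator hmA'.compl, lintegral_add_compl _ hmA']
      _ ≤ 1 := ih htT.le

/-- Markov's inequality for the exponential of `logWealth`. -/
theorem IsBanditInteraction.measure_le_logWealth [IsProbabilityMeasure ν]
    [IsProbabilityMeasure μ] (h : IsBanditInteraction T ν μ ℱ U p I)
    (hν : ∀ᵐ v ∂ν, ∀ i n, v i n ∈ Set.Icc (0 : ℝ) 1) {lam : ℝ} (hlam : |lam| ≤ 1) (i : Fin K)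
    (n : Fin N) {t : ℕ} (ht : t ≤ T) (x : ℝ) :
    μ.real {ω | x ≤ logWealth lam (meanUtility ν i n) (fun τ => I τ ω) (fun τ => U τ ω) t i n}
      ≤ Real.exp (-x) := by
  set Z := fun ω => logWealth lam (meanUtility ν i n) (fun τ => I τ ω) (fun τ => U τ ω) t i n
  have hmZ : Measurable Z :=
    (h.measurable_logWealth ht lam (meanUtility ν i n) i n).mono (ℱ.le t) le_rfl
  have h1 := mul_meas_ge_le_lintegral₀ (μ := μ) (f := fun ω => ENNReal.ofReal (Real.exp (Z ω)))
    (ENNReal.measurable_ofReal.comp (Real.measurable_exp.comp hmZ)).aemeasurable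
    (ENNReal.ofReal (Real.exp x))
  have h2 : {ω | ENNReal.ofReal (Real.exp x) ≤ ENNReal.ofReal (Real.exp (Z ω))}
      = {ω | x ≤ Z ω} := by
    ext ω
    simp only [Set.mem_ofPred_eq]
    rw [ENNReal.ofReal_le_ofReal_iff (Real.exp_pos _).le, Real.exp_le_exp]
  rw [h2] at h1
  have h3 := h1.trans (h.lintegral_exp_logWealth_le_one hν hlam i n ht)
  have h4 := ENNReal.toReal_mono ENNReal.one_ne_top h3
  rw [ENNReal.toReal_mul, ENNReal.toReal_ofReal (Real.exp_pos _).le, ENNReal.toReal_one] at h4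
  rw [Real.exp_neg, ← one_div, le_div_iff₀ (Real.exp_pos _), mul_comm]
  exact h4

/-- The event that, after `t` rounds, some empirical mean deviates by more than its confidence
width. -/
noncomputable def deviationEvent (L : ℝ) (T : ℕ) (u : Fin K → Fin N → ℝ) (U : ℕ → Ω → Fin K → Fin N → ℝ)
    (I : ℕ → Ω → Fin K) (t : ℕ) : Set Ω :=
  ⋃ x : (Fin K × Fin N) × Fin (T + 1) × Bool,
    {ω | 2 * L ≤ logWealth (cond x.2.2 (deviationRate L (u x.1.1 x.1.2) x.2.1)
      (-deviationRate L (u x.1.1 x.1.2) x.2.1)) (u x.1.1 x.1.2) (fun τ => I τ ω)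
      (fun τ => U τ ω) t x.1.1 x.1.2}

theorem IsBanditInteraction.measurableSet_deviationEvent (h : IsBanditInteraction T ν μ ℱ U p I)
    {t : ℕ} (ht : t ≤ T) (L : ℝ) (u : Fin K → Fin N → ℝ) :
    MeasurableSet (deviationEvent L T u U I t) :=
  MeasurableSet.iUnion fun _ => measurableSet_le measurable_const
    ((h.measurable_logWealth ht _ _ _ _).mono (ℱ.le t) le_rfl)

/-- The optimal tuning depends on the random pull count, so the union runs over all `T + 1` possible
counts, besides entries and signs. -/
theorem IsBanditInteraction.measureReal_deviationEvent_le [IsProbabilityMeasure ν]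
    [IsProbabilityMeasure μ] (h : IsBanditInteraction T ν μ ℱ U p I)
    (hν : ∀ᵐ v ∂ν, ∀ i n, v i n ∈ Set.Icc (0 : ℝ) 1) {L : ℝ} (hL : 0 ≤ L) {t : ℕ} (ht : t ≤ T) :
    μ.real (deviationEvent L T (meanUtility ν) U I t)
      ≤ 2 * K * N * (T + 1) * Real.exp (-(2 * L)) := by
  refine (measureReal_iUnion_fintype_le _).trans ?_
  calc _ ≤ ∑ _x : (Fin K × Fin N) × Fin (T + 1) × Bool, Real.exp (-(2 * L)) := by
        refine Finset.sum_le_sum fun x _ => h.measure_le_logWealth hν ?_ _ _ ht _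
        have h1 : |deviationRate L (meanUtility ν x.1.1 x.1.2) x.2.1| ≤ 1 := by
          rw [abs_of_nonneg (deviationRate_nonneg _ _ _)]
          exact deviationRate_le_one hL _
        cases x.2.2
        · simpa using h1
        · exact h1
    _ = _ := by
        simp only [Finset.sum_const, Finset.card_univ, Fintype.card_prod, Fintype.card_fin,
          Fintype.card_bool, nsmul_eq_mul]
        push_cast; ring

theorem logWealth_lt_of_notMem_deviationEvent {L : ℝ} {u : Fin K → Fin N → ℝ} {t : ℕ} {ω : Ω}
    (hω : ω ∉ deviationEvent L T u U I t) (i : Fin K) (n : Fin N) {s : ℕ} (hs : s ≤ T) :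
    logWealth (deviationRate L (u i n) s) (u i n) (fun τ => I τ ω) (fun τ => U τ ω) t i n < 2 * L ∧
    logWealth (-deviationRate L (u i n) s) (u i n) (fun τ => I τ ω) (fun τ => U τ ω) t i n
      < 2 * L := by
  simp only [deviationEvent, Set.mem_iUnion, Set.mem_ofPred_eq, not_exists, not_le] at hω
  exact ⟨hω ((i, n), ⟨s, by omega⟩, true), hω ((i, n), ⟨s, by omega⟩, false)⟩

/-! ### Confidence bounds for the algorithm -/

theorem IsBanditInteraction.ae_utility_mem_Icc (h : IsBanditInteraction T ν μ ℱ U p I)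
    (hν : ∀ᵐ v ∂ν, ∀ i n, v i n ∈ Set.Icc (0 : ℝ) 1) :
    ∀ᵐ ω ∂μ, ∀ t < T, ∀ i n, U (t + 1) ω i n ∈ Set.Icc (0 : ℝ) 1 := by
  rw [ae_all_iff]
  intro t
  by_cases ht : t < T
  · have h1 := h.utility_law t ht
    rw [← h1.map_eq] at hν
    filter_upwards [ae_of_ae_map h1.aemeasurable hν] with ω hω _ using hω
  · exact Filter.Eventually.of_forall fun ω h => absurd h ht

theorem empiricalMean_nonneg {a : ℕ → Fin K} {v : ℕ → Fin K → Fin N → ℝ} {t : ℕ}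
    (hv : ∀ s < t, ∀ i n, 0 ≤ v (s + 1) i n) (i : Fin K) (n : Fin N) :
    0 ≤ empiricalMean a v t i n := by
  refine div_nonneg (Finset.sum_nonneg fun τ hτ => ?_) (Nat.cast_nonneg _)
  obtain ⟨h1, h2⟩ := Finset.mem_Icc.mp hτ
  obtain ⟨τ, rfl⟩ : ∃ σ, τ = σ + 1 := ⟨τ - 1, by omega⟩
  split_ifs
  · exact hv τ (by omega) i n
  · exact le_rfl

/-- Outside the deviation event the upper confidence matrix dominates the mean utilities, and its
excess is controlled by the pull counts. -/
theorem upperConfidence_bounds {L : ℝ} (hLdef : L = Real.log (N * K * T ^ 2)) (hL : 1 / 25 ≤ L)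
    {u : Fin K → Fin N → ℝ} (hu : ∀ i n, u i n ∈ Set.Icc (0 : ℝ) 1) {t : ℕ} (ht : t ≤ T) {ω : Ω}
    (hU : ∀ s < t, ∀ i n, 0 ≤ U (s + 1) ω i n) (hω : ω ∉ deviationEvent L T u U I t)
    (i : Fin K) (n : Fin N) :
    u i n ≤ upperConfidence T (fun τ => I τ ω) (fun τ => U τ ω) t i n ∧
    upperConfidence T (fun τ => I τ ω) (fun τ => U τ ω) t i n
      ≤ (√(u i n) + √(25 * L / max (pullCount (fun τ => I τ ω) t i : ℝ) 1)) ^ 2 := by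
  unfold upperConfidence
  rw [← hLdef]
  by_cases hs : pullCount (fun τ => I τ ω) t i = 0
  · rw [if_pos hs, hs]
    refine ⟨(hu i n).2, ?_⟩
    -- For an arm not yet pulled the default value 1 must fit under the width; this needs `25 * L ≥
    -- 1`.
    have h1 : 1 ≤ √(25 * L / max ((0 : ℕ) : ℝ) 1) := by
      rw [Real.one_le_sqrt]; norm_num; linarith
    have h2 := Real.sqrt_nonneg (u i n)
    exact one_le_pow₀ (by linarith)
  · have h1 : (1 : ℝ) ≤ pullCount (fun τ => I τ ω) t i := by
      exact_mod_cast Nat.one_le_iff_ne_zero.mpr hs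
    rw [if_neg hs, max_eq_left h1]
    obtain ⟨hp, hm⟩ := logWealth_lt_of_notMem_deviationEvent hω i n
      ((pullCount_le (fun τ => I τ ω) t i).trans ht)
    exact confidence_of_logWealth_lt (by linarith) (hu i n).1 (empiricalMean_nonneg hU i n)
      hs hp hm

/-! ### Expected regret per round -/

theorem measurable_welfare (u : Fin K → Fin N → ℝ) : Measurable (welfare u) := by
  unfold welfare NSW expectedUtility
  fun_prop

theorem IsBanditInteraction.measurable_strategy (h : IsBanditInteraction T ν μ ℱ U p I) {t : ℕ}
    (ht : t < T) : Measurable (p (t + 1)) :=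
  (h.strategy_measurable t ht).mono (ℱ.le t) le_rfl

/-- The conditional average of a known function of the arms is its mean under the strategy. -/
theorem IsBanditInteraction.integral_strategy_mul [IsProbabilityMeasure μ]
    (h : IsBanditInteraction T ν μ ℱ U p I) {t : ℕ} (ht : t < T) {g : Fin K → Ω → ℝ}
    (hg : ∀ i, Measurable[ℱ t] (g i)) {b : ℝ} (hb : ∀ i ω, |g i ω| ≤ b) :
    Integrable (fun ω => ∑ i, p (t + 1) ω i * g i ω) μ ∧
    Integrable (fun ω => g (I (t + 1) ω) ω) μ ∧
    ∫ ω, ∑ i, p (t + 1) ω i * g i ω ∂μ = ∫ ω, g (I (t + 1) ω) ω ∂μ := by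
  have hI : Measurable (I (t + 1)) := (h.arm_measurable t ht).mono (ℱ.le _) le_rfl
  have hA : ∀ i, MeasurableSet {ω | I (t + 1) ω = i} := fun i => hI (measurableSet_singleton i)
  have hind : ∀ i, Integrable (Set.indicator {ω | I (t + 1) ω = i} fun _ => (1 : ℝ)) μ :=
    fun i => (integrable_const 1).indicator (hA i)
  -- `g i` is known at time `t`, so it leaves the conditional expectation, and what remains is the
  -- probability of arm `i`.
  have hpull : ∀ i, μ[g i * Set.indicator {ω | I (t + 1) ω = i} (fun _ => (1 : ℝ)) | ℱ t]
      =ᵐ[μ] fun ω => p (t + 1) ω i * g i ω := by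
    intro i
    have h1 := condExp_stronglyMeasurable_mul_of_bound (ℱ.le t) (hg i).stronglyMeasurable
      (hind i) b (Filter.Eventually.of_forall fun ω => hb i ω)
    filter_upwards [h1, h.arm_law t ht i] with ω h2 h3
    rw [h2, Pi.mul_apply, h3, mul_comm]
  have hint : ∀ i, Integrable (fun ω => p (t + 1) ω i * g i ω) μ :=
    fun i => integrable_condExp.congr (hpull i)
  have hint' : ∀ i, Integrable (g i * Set.indicator {ω | I (t + 1) ω = i} fun _ => (1 : ℝ)) μ :=
    fun i => (hind i).bdd_mul ((hg i).mono (ℱ.le t) le_rfl).aestronglyMeasurable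
      (Filter.Eventually.of_forall fun ω => hb i ω)
  have hsum : (fun ω => g (I (t + 1) ω) ω)
      = fun ω => ∑ i, (g i * Set.indicator {ω | I (t + 1) ω = i} fun _ => (1 : ℝ)) ω := by
    funext ω
    simp [Set.indicator_apply]
  refine ⟨integrable_finsetSum _ fun i _ => hint i, ?_, ?_⟩
  · rw [hsum]; exact integrable_finsetSum _ fun i _ => hint' i
  · rw [hsum, integral_finsetSum _ fun i _ => hint i, integral_finsetSum _ fun i _ => hint' i]
    refine Finset.sum_congr rfl fun i _ => ?_
    rw [← integral_congr_ae (hpull i), integral_condExp (ℱ.le t)]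

theorem IsBanditInteraction.integrable_welfare [IsProbabilityMeasure μ]
    (h : IsBanditInteraction T ν μ ℱ U p I) {u : Fin K → Fin N → ℝ}
    (hu : ∀ i n, u i n ∈ Set.Icc (0 : ℝ) 1) {t : ℕ} (ht : t < T) :
    Integrable (fun ω => welfare u (p (t + 1) ω)) μ :=
  integrable_of_ae_mem_Icc ((measurable_welfare u).comp (h.measurable_strategy ht))
    ((h.strategy_mem t ht).mono fun _ hω => welfare_mem_Icc hu hω)

theorem meanUtility_mem_Icc [IsProbabilityMeasure ν]
    (hν : ∀ᵐ v ∂ν, ∀ i n, v i n ∈ Set.Icc (0 : ℝ) 1) (i : Fin K) (n : Fin N) :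
    meanUtility ν i n ∈ Set.Icc (0 : ℝ) 1 :=
  integral_mem_Icc (measurable_utility_entry i n) (hν.mono fun _ hv => hv i n)

/-- Expected loss of a round in which the strategy is optimistic. -/
theorem IsBanditInteraction.welfare_sub_integral_le [IsProbabilityMeasure ν]
    [IsProbabilityMeasure μ] (h : IsBanditInteraction T ν μ ℱ U p I) (hN : 2 ≤ N)
    (hν : ∀ᵐ v ∂ν, ∀ i n, v i n ∈ Set.Icc (0 : ℝ) 1) {L : ℝ}
    (hLdef : L = Real.log (N * K * T ^ 2)) (hL : 1 / 25 ≤ L) {t : ℕ} (ht : t < T)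
    (hmax : ∀ᵐ ω ∂μ, IsMaxOn (welfare (upperConfidence T (fun τ => I τ ω) (fun τ => U τ ω) t))
      (stdSimplex ℝ (Fin K)) (p (t + 1) ω))
    {q : Fin K → ℝ} (hq : q ∈ stdSimplex ℝ (Fin K)) {a : ℝ} (ha : 0 < a) :
    welfare (meanUtility ν) q - ∫ ω, welfare (meanUtility ν) (p (t + 1) ω) ∂μ
      ≤ μ.real (deviationEvent L T (meanUtility ν) U I t)
        + 16 * (a ^ (1 / (N : ℝ)) + (a ^ (1 / (N : ℝ) - 1) + 1) *
          ∫ ω, 25 * L / max (pullCount (fun τ => I τ ω) t (I (t + 1) ω) : ℝ) 1 ∂μ) := by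
  set u := meanUtility ν
  have hu : ∀ i n, u i n ∈ Set.Icc (0 : ℝ) 1 := meanUtility_mem_Icc hν
  set B := deviationEvent L T u U I t
  have hB : MeasurableSet B := h.measurableSet_deviationEvent ht.le L u
  set g : Fin K → Ω → ℝ := fun i ω => 25 * L / max (pullCount (fun τ => I τ ω) t i : ℝ) 1
  have hg0 : ∀ i ω, 0 ≤ g i ω := fun i ω => by positivity
  have hgm : ∀ i, Measurable[ℱ t] (g i) := fun i => by
    have h1 : Measurable fun k : ℕ => 25 * L / max (k : ℝ) 1 := measurable_from_top
    exact h1.comp (h.measurable_pullCount ht.le i)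
  have hgb : ∀ i ω, |g i ω| ≤ 25 * L := fun i ω => by
    rw [abs_of_nonneg (hg0 i ω)]
    exact div_le_self (by linarith) (le_max_right _ _)
  obtain ⟨hint, -, heq⟩ := h.integral_strategy_mul ht hgm hgb
  set A : ℝ := a ^ (1 / (N : ℝ))
  set D : ℝ := a ^ (1 / (N : ℝ) - 1) + 1
  have hA0 : 0 ≤ A := Real.rpow_nonneg ha.le _
  have hD0 : 0 ≤ D := add_nonneg (Real.rpow_nonneg ha.le _) zero_le_one
  have hpt : ∀ᵐ ω ∂μ, welfare u q - welfare u (p (t + 1) ω)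
      ≤ B.indicator (fun _ => 1) ω + 16 * (A + D * ∑ i, p (t + 1) ω i * g i ω) := by
    filter_upwards [hmax, h.strategy_mem t ht, h.ae_utility_mem_Icc hν] with ω h1 h2 h3
    have hw : 0 ≤ ∑ i, p (t + 1) ω i * g i ω :=
      Finset.sum_nonneg fun i _ => mul_nonneg (h2.1 i) (hg0 i ω)
    -- On the deviation event the loss is bounded by 1, elsewhere by optimism.
    by_cases hω : ω ∈ B
    · rw [Set.indicator_of_mem hω]
      have h4 := (welfare_mem_Icc hu hq).2
      have h5 := (welfare_mem_Icc hu h2).1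
      have := mul_nonneg hD0 hw
      linarith
    · rw [Set.indicator_of_notMem hω, zero_add]
      have hbd := upperConfidence_bounds hLdef hL hu ht.le
        (fun s hs i n => (h3 s (by omega) i n).1) hω
      exact welfare_sub_le_of_isMaxOn hN hu (fun i n => (hbd i n).1) (fun i => hg0 i ω)
        (fun i n => (hbd i n).2) h2 hq h1 ha
  have hi1 := h.integrable_welfare hu ht
  have hi2 : Integrable (B.indicator fun _ => (1 : ℝ)) μ := (integrable_const 1).indicator hB
  have hi3 : Integrable (fun ω => A + D * ∑ i, p (t + 1) ω i * g i ω) μ :=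
    (integrable_const A).add (hint.const_mul D)
  have h6 := integral_mono_ae ((integrable_const (welfare u q)).sub hi1)
    (hi2.add (hi3.const_mul 16)) hpt
  simp only [Pi.add_apply, Pi.sub_apply] at h6
  rw [integral_sub (integrable_const _) hi1, integral_add hi2 (hi3.const_mul 16),
    integral_const_mul, integral_add (integrable_const A) (hint.const_mul D), integral_const_mul,
    heq, integral_indicator_const _ hB] at h6
  simpa using h6

/-! ### Total regret -/

theorem sum_Icc_one_eq_sum_range {M : Type*} [AddCommMonoid M] (f : ℕ → M) (T : ℕ) :
    ∑ t ∈ Finset.Icc 1 T, f t = ∑ t ∈ Finset.range T, f (t + 1) := by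
  induction T with
  | zero => simp
  | succ T ih => rw [Finset.sum_Icc_succ_top (by omega), Finset.sum_range_succ, ih]

theorem sum_ite_cast_le {x : ℝ} (hx : 0 ≤ x) (T : ℕ) :
    ∑ t ∈ Finset.range T, (if ((t + 1 : ℕ) : ℝ) ≤ x then (1 : ℝ) else 0) ≤ x := by
  rw [← Finset.sum_filter, Finset.sum_const, nsmul_eq_mul, mul_one]
  have h1 : (Finset.range T).filter (fun t => ((t + 1 : ℕ) : ℝ) ≤ x) ⊆ Finset.range ⌊x⌋₊ := by
    intro t ht
    rw [Finset.mem_range]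
    exact Nat.le_floor (Finset.mem_filter.mp ht).2
  calc _ ≤ ((⌊x⌋₊ : ℕ) : ℝ) := by
        exact_mod_cast (Finset.card_le_card h1).trans_eq (Finset.card_range _)
    _ ≤ x := Nat.floor_le hx

theorem IsBanditInteraction.sum_integral_width_le [IsProbabilityMeasure μ]
    (h : IsBanditInteraction T ν μ ℱ U p I) {c : ℝ} (hc : 0 ≤ c) :
    ∑ t ∈ Finset.range T, ∫ ω, c / max (pullCount (fun τ => I τ ω) t (I (t + 1) ω) : ℝ) 1 ∂μ
      ≤ c * (K * (2 + Real.log T)) := by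
  have hint : ∀ t ∈ Finset.range T, Integrable
      (fun ω => c / max (pullCount (fun τ => I τ ω) t (I (t + 1) ω) : ℝ) 1) μ := by
    intro t ht
    have ht := Finset.mem_range.mp ht
    have hm : Measurable fun k : ℕ => c / max (k : ℝ) 1 := measurable_from_top
    refine (h.integral_strategy_mul ht
      (g := fun i ω => c / max (pullCount (fun τ => I τ ω) t i : ℝ) 1)
      (fun i => hm.comp (h.measurable_pullCount ht.le i)) (b := c) fun i ω => ?_).2.1
    rw [abs_of_nonneg (by positivity)]
    exact div_le_self hc (le_max_right _ _)
  rw [← integral_finsetSum _ hint]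
  refine (integral_mono (integrable_finsetSum _ hint) (integrable_const _)
    (g := fun _ => c * (K * (2 + Real.log T))) fun ω => ?_).trans_eq (by simp)
  have h1 := mul_le_mul_of_nonneg_left (sum_inv_max_pullCount_le (fun τ => I τ ω) T) hc
  simpa only [Finset.mul_sum, mul_one_div] using h1

/-- Regret bound in terms of the confidence parameter `L` and a free parameter `a`. -/
theorem regret_le [IsProbabilityMeasure ν] [IsProbabilityMeasure μ]
    (h : IsBanditInteraction T ν μ ℱ U p I) (hN : 2 ≤ N) (hK : 1 ≤ K) (hT : 1 ≤ T)
    (hν : ∀ᵐ v ∂ν, ∀ i n, v i n ∈ Set.Icc (0 : ℝ) 1) {N₀ : ℝ} (hN₀ : 0 ≤ N₀)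
    (hplay : PlaysUCB T N₀ μ U p I) {L : ℝ}
    (hLdef : L = Real.log (N * K * T ^ 2)) (hL : 1 / 25 ≤ L) {a : ℝ} (ha : 0 < a) :
    regret T (meanUtility ν) μ p ≤ K * N₀
      + T * (2 * K * N * (T + 1) * Real.exp (-(2 * L)))
      + 16 * (T * a ^ (1 / (N : ℝ))
        + (a ^ (1 / (N : ℝ) - 1) + 1) * (25 * L * (K * (2 + Real.log T)))) := by
  have hu : ∀ i n, meanUtility ν i n ∈ Set.Icc (0 : ℝ) 1 := meanUtility_mem_Icc hν
  have hTpos : (0 : ℝ) < T := by exact_mod_cast hT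
  have hD0 : 0 ≤ a ^ (1 / (N : ℝ) - 1) + 1 := add_nonneg (Real.rpow_nonneg ha.le _) zero_le_one
  have hA0 : 0 ≤ a ^ (1 / (N : ℝ)) := Real.rpow_nonneg ha.le _
  set W : ℕ → ℝ := fun t =>
    ∫ ω, 25 * L / max (pullCount (fun τ => I τ ω) t (I (t + 1) ω) : ℝ) 1 ∂μ
  have hW0 : ∀ t, 0 ≤ W t := fun t => integral_nonneg fun ω => by positivity
  set R : ℝ := 2 * K * N * (T + 1) * Real.exp (-(2 * L)) with hR
  have hR0 : 0 ≤ R := by positivity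
  have hround : ∀ q ∈ stdSimplex ℝ (Fin K), ∀ t ∈ Finset.range T,
      welfare (meanUtility ν) q - ∫ ω, welfare (meanUtility ν) (p (t + 1) ω) ∂μ
        ≤ (if ((t + 1 : ℕ) : ℝ) ≤ K * N₀ then (1 : ℝ) else 0) + R
          + 16 * (a ^ (1 / (N : ℝ)) + (a ^ (1 / (N : ℝ) - 1) + 1) * W t) := by
    intro q hq t ht
    have ht := Finset.mem_range.mp ht
    -- Warm-up rounds are charged the trivial loss 1; the other terms are nonnegative.
    split_ifs with hw
    · have h1 := (welfare_mem_Icc hu hq).2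
      have h2 : 0 ≤ ∫ ω, welfare (meanUtility ν) (p (t + 1) ω) ∂μ :=
        integral_nonneg_of_ae ((h.strategy_mem t ht).mono fun ω hω => (welfare_mem_Icc hu hω).1)
      have h3 := mul_nonneg hD0 (hW0 t)
      linarith
    · have h1 := h.welfare_sub_integral_le hN hν hLdef hL ht
        (hplay.optimistic t ht (not_le.mp hw)) hq ha
      have h2 := h.measureReal_deviationEvent_le hν (by linarith : (0 : ℝ) ≤ L) ht.le
      linarith
  have hsum : ∀ q ∈ stdSimplex ℝ (Fin K), T * welfare (meanUtility ν) q
      - ∑ t ∈ Finset.range T, ∫ ω, welfare (meanUtility ν) (p (t + 1) ω) ∂μ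
        ≤ K * N₀ + T * R + 16 * (T * a ^ (1 / (N : ℝ))
        + (a ^ (1 / (N : ℝ) - 1) + 1) * (25 * L * (K * (2 + Real.log T)))) := by
    intro q hq
    have h1 := Finset.sum_le_sum (hround q hq)
    rw [Finset.sum_sub_distrib, Finset.sum_add_distrib, Finset.sum_add_distrib] at h1
    simp only [Finset.sum_const, Finset.card_range, nsmul_eq_mul] at h1
    rw [← Finset.mul_sum, Finset.sum_add_distrib, ← Finset.mul_sum] at h1
    simp only [Finset.sum_const, Finset.card_range, nsmul_eq_mul] at h1
    have h2 := sum_ite_cast_le (by positivity : 0 ≤ K * N₀) T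
    have h3 := mul_le_mul_of_nonneg_left
      (h.sum_integral_width_le (by linarith : 0 ≤ 25 * L)) hD0
    linarith
  have hsup : sSup (welfare (meanUtility ν) '' stdSimplex ℝ (Fin K)) ≤
      (K * N₀ + T * R + 16 * (T * a ^ (1 / (N : ℝ))
        + (a ^ (1 / (N : ℝ) - 1) + 1) * (25 * L * (K * (2 + Real.log T))))
        + ∑ t ∈ Finset.range T, ∫ ω, welfare (meanUtility ν) (p (t + 1) ω) ∂μ) / T := by
    refine csSup_le (Set.Nonempty.image _ ⟨_, single_mem_stdSimplex ℝ (⟨0, hK⟩ : Fin K)⟩) ?_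
    rintro _ ⟨q, hq, rfl⟩
    rw [le_div_iff₀ hTpos]
    linarith [hsum q hq]
  rw [le_div_iff₀ hTpos] at hsup
  unfold regret
  simp_rw [sum_Icc_one_eq_sum_range]
  rw [integral_finsetSum _ fun t ht => h.integrable_welfare hu (Finset.mem_range.mp ht)]
  linarith

end NashBandit

open NashBandit in
theorem theorem1 :
    ∃ (C : ℝ) (m : ℕ), ∀ (N K T : ℕ), 2 ≤ N → 1 ≤ K → 1 ≤ T →
      ∀ (ν : Measure (Fin K → Fin N → ℝ)) [IsProbabilityMeasure ν],
        (∀ᵐ v ∂ν, ∀ i n, v i n ∈ Set.Icc (0 : ℝ) 1) →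
      ∀ (Ω : Type*) (mΩ : MeasurableSpace Ω) (μ : Measure Ω) [IsProbabilityMeasure μ]
        (ℱ : Filtration ℕ mΩ) (U : ℕ → Ω → Fin K → Fin N → ℝ) (p : ℕ → Ω → Fin K → ℝ)
        (I : ℕ → Ω → Fin K),
        NashBandit.IsBanditInteraction T ν μ ℱ U p I →
        NashBandit.PlaysUCB T (1 + 18 * Real.log (K * T)) μ U p I →
        NashBandit.regret T (NashBandit.meanUtility ν) μ p ≤
          C * (1 + Real.log (N * K * T)) ^ m *
            ((K : ℝ) ^ (2 / (N : ℝ)) * (T : ℝ) ^ (((N : ℝ) - 1) / (N : ℝ)) + K) := by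
  -- Warm-up, deviations and widths give at most 1616 for `Q` and 18 + 2 + 1600 for `K`. The
  -- exponent 2 comes from `L * (2 + log T)`.
  refine ⟨1700, 2, fun N K T hN hK hT ν _ hν Ω mΩ μ _ ℱ U p I hplay hucb => ?_⟩
  have hNr : (2 : ℝ) ≤ N := by exact_mod_cast hN
  have hKr : (1 : ℝ) ≤ K := by exact_mod_cast hK
  have hTr : (1 : ℝ) ≤ T := by exact_mod_cast hT
  have hlogN : 1 / 25 ≤ Real.log N := by
    have h1 := Real.log_two_gt_d9
    have h2 := Real.log_le_log (by norm_num) hNr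
    linarith
  have hlogK := Real.log_nonneg hKr
  have hlogT := Real.log_nonneg hTr
  have hNK : (0 : ℝ) < N * K := by positivity
  have hL : Real.log (N * K * T ^ 2) = Real.log N + Real.log K + 2 * Real.log T := by
    rw [Real.log_mul hNK.ne' (by positivity), Real.log_mul (by positivity) (by positivity),
      Real.log_pow]
    push_cast; ring
  have hKT : Real.log (K * T) = Real.log K + Real.log T :=
    Real.log_mul (by positivity) (by positivity)
  have hl : Real.log (N * K * T) = Real.log N + Real.log K + Real.log T := by
    rw [Real.log_mul hNK.ne' (by positivity), Real.log_mul (by positivity) (by positivity)]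
  -- `a = K / T` balances `T * a ^ β` with `a ^ (β - 1) * K`: both equal `K ^ β * T ^ (1 - β)`.
  have hmain := regret_le hplay hN hK hT hν (by rw [hKT]; linarith) hucb rfl
    (by rw [hL]; linarith) (a := K / T) (by positivity)
  set l := 1 + Real.log (N * K * T)
  set L := Real.log (N * K * T ^ 2) with hLdef
  set β : ℝ := 1 / N with hβ
  set Q : ℝ := (K : ℝ) ^ (2 / (N : ℝ)) * (T : ℝ) ^ (((N : ℝ) - 1) / (N : ℝ))
  have hl1 : 1 ≤ l := by linarith
  have hl2 : l ≤ l ^ 2 := by nlinarith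
  have hPQ : (K : ℝ) ^ β * (T : ℝ) ^ (1 - β) ≤ Q := by
    have h1 : ((N : ℝ) - 1) / N = 1 - β := by rw [hβ]; field_simp
    change _ ≤ (K : ℝ) ^ (2 / (N : ℝ)) * (T : ℝ) ^ (((N : ℝ) - 1) / (N : ℝ))
    rw [h1]
    gcongr
    rw [hβ]
    gcongr
    norm_num
  have hP1 : T * ((K : ℝ) / T) ^ β = (K : ℝ) ^ β * (T : ℝ) ^ (1 - β) := by
    rw [Real.div_rpow (by positivity) (by positivity), Real.rpow_sub (by positivity),
      Real.rpow_one]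
    ring
  have hP2 : ((K : ℝ) / T) ^ (β - 1) * K = (K : ℝ) ^ β * (T : ℝ) ^ (1 - β) := by
    rw [← hP1, Real.rpow_sub_one (by positivity)]
    field_simp
  -- With `X = N * K * T ^ 2`, `exp (-(2 * L)) = 1 / X ^ 2` while the prefactor is at most `4 * X`;
  -- then `X ≥ 2`.
  have hbad : T * (2 * K * N * (T + 1) * Real.exp (-(2 * L))) ≤ 2 := by
    have hX : (0 : ℝ) < N * K * T ^ 2 := by positivity
    have h1 : Real.exp (-(2 * L)) = 1 / (N * K * T ^ 2) ^ 2 := by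
      rw [Real.exp_neg, two_mul, Real.exp_add, hLdef, Real.exp_log hX, ← sq, one_div]
    have h2 : (2 : ℝ) ≤ N * K * T ^ 2 := by
      have := one_le_mul_of_one_le_of_one_le hKr (one_le_pow₀ hTr (n := 2))
      nlinarith
    rw [h1, mul_one_div, mul_div_assoc', div_le_iff₀ (by positivity)]
    have h3 : T * (2 * K * N * ((T : ℝ) + 1)) ≤ 4 * (N * K * T ^ 2) := by
      have : 0 ≤ N * K * T * ((T : ℝ) - 1) := mul_nonneg (by positivity) (by linarith)
      nlinarith
    nlinarith
  have hLl : 0 ≤ L ∧ L ≤ 2 * l := ⟨by linarith, by linarith⟩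
  have hLT : L * (2 + Real.log T) ≤ 4 * l ^ 2 := by
    calc L * (2 + Real.log T) ≤ (2 * l) * (2 * l) :=
          mul_le_mul hLl.2 (by linarith) (by linarith) (by linarith)
      _ = 4 * l ^ 2 := by ring
  have hQ0 : 0 ≤ Q := by positivity
  have hwarm : K * (1 + 18 * Real.log (K * T)) ≤ 18 * l ^ 2 * K := by
    rw [mul_comm]
    exact mul_le_mul_of_nonneg_right (by linarith) (by linarith)
  have hwidth : (((K : ℝ) / T) ^ (β - 1) + 1) * (25 * L * (K * (2 + Real.log T)))
      ≤ 100 * l ^ 2 * (Q + K) := by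
    calc _ = 25 * (L * (2 + Real.log T)) * (((K : ℝ) / T) ^ (β - 1) * K + K) := by ring
      _ ≤ 25 * (4 * l ^ 2) * (Q + K) := by rw [hP2]; gcongr
      _ = _ := by ring
  have hlK : 1 ≤ l ^ 2 * K := one_le_mul_of_one_le_of_one_le (by linarith) hKr
  have hlQ : Q ≤ l ^ 2 * Q := le_mul_of_one_le_left hQ0 (by linarith)
  nlinarith
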